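/- Fix finitely many fields $f_1,\dots,f_k$, where field $f$ takes values in $\{0,\dots,N_f-1\}$. A packet assigns a value to every field, and a history is a nonempty finite list of packets, whose first entry is its head packet. Let $H$ be the (countable) set of histories, and give $2^H$ the inclusion order, its Scott topology $\mathcal O$, and the Borel $\sigma$-algebra $\mathcal B$ of the Cantor topology (the one generated by the sets $\{c : h\in c\}$, $h\in H$, and their complements). For probability measures on $(2^H,\mathcal B)$ put $\mu\sqsubseteq\nu$ iff $\mu(B)\le\nu(B)$ for all $B\in\mathcal O$; for Markov kernels on $2^H$ put $P\sqsubseteq Q$ iff $P(a,-)\sqsubseteq Q(a,-)$ for all $a\subseteq H$. A Markov kernel $P$ on $2^H$ is continuous if $a\mapsto P(a,B)$ is Scott-continuous for every $B\in\mathcal O$. For maps $P,Q$ from $2^H$ to measures on $2^H$ write $\mu\mathbin{>\!\!>\!\!=}P=\int P(a)\,\mu(da)$, let $\delta_a$ be the Dirac measure, and put $1(a)=\delta_a$, $(P\mathbin{;}Q)(a)=P(a)\mathbin{>\!\!>\!\!=}Q$, $(P\mathbin{\&}Q)(a)=P(a)\mathbin{>\!\!>\!\!=}\lambda b_1.\,Q(a)\mathbin{>\!\!>\!\!=}\lambda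 b_2.\,\delta_{b_1\cup b_2}$, and $P\oplus_r Q=rP+(1-r)Q$. Let $P^{(0)}=1$, $P^{(n+1)}=1\mathbin{\&}(P\mathbin{;}P^{(n)})$ and $P^*(a)=\bigsqcup_n P^{(n)}(a)$, the supremum being taken in the probability measures ordered by $\sqsubseteq$. Predicates are $t,u::=0\mid 1\mid f=n\mid t\mathbin{\&}u\mid t\mathbin{;}u\mid\neg t$, and ProbNetKAT programs are $p,q::=t\mid f\leftarrow n\mid \mathrm{dup}\mid p\mathbin{\&}q\mid p\mathbin{;}q\mid p\oplus_r q\mid p^*$ with $r\in[0,1]$. Denotations are given by $[\![0]\!](a)=\delta_\emptyset$; $[\![1]\!](a)=\delta_a$; $[\![f=n]\!](a)=\delta_{b}$, where $b$ is the set of histories in $a$ whose head packet has $f$-value $n$; $[\![\neg t]\!](a)=[\![t]\!](a)\mathbin{>\!\!>\!\!=}\lambda b.\,\delta_{a\setminus b}$; $[\![f\leftarrow n]\!](a)=\delta_b$, where $b$ is obtained from $a$ by setting field $f$ of every head packet to $n$; $[\![\mathrm{dup}]\!](a)=\delta_b$, where $b$ is obtained from $a$ by duplicating every head packet; and the remaining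 constructs are interpreted by the operations above. Then: 1. Every ProbNetKAT program denotes a continuous Markov kernel. 2. For every continuous Markov kernel $P$, the map $Q\mapsto 1\mathbin{\&}(P\mathbin{;}Q)$ sends continuous Markov kernels to continuous Markov kernels; the $P^{(n)}$ are continuous Markov kernels and increase with $n$; for every $a$ the supremum $\bigsqcup_n P^{(n)}(a)$ exists in the probability measures; and $P^*$ is a continuous Markov kernel, is the supremum of the $P^{(n)}$ in the continuous Markov kernels, and is the least fixpoint of $Q\mapsto 1\mathbin{\&}(P\mathbin{;}Q)$ among them. -/

import Mathlib

open MeasureTheory ProbabilityTheory Set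

namespace ProbNetKAT

/-! Packets, histories and programs. There are `k` fields; field `f` takes the values
`0, …, N f - 1`. -/

/-- A packet is a record assigning a bounded integer to each of the finitely many fields. -/
abbrev Packet {k : ℕ} (N : Fin k → ℕ) : Type := (f : Fin k) → Fin (N f)

/-- A history is a nonempty list of packets: a head packet and a possibly empty tail. -/
abbrev History {k : ℕ} (N : Fin k → ℕ) : Type := Packet N × List (Packet N)

/-- Predicates. -/
inductive Pred {k : ℕ} (N : Fin k → ℕ) : Type
  | drop : Pred N
  | skip : Pred N
  | test (f : Fin k) (n : Fin (N f)) : Pred N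
  | disj (t u : Pred N) : Pred N
  | conj (t u : Pred N) : Pred N
  | neg (t : Pred N) : Pred N

/-- Programs. -/
inductive Prog {k : ℕ} (N : Fin k → ℕ) : Type
  | filter (t : Pred N) : Prog N
  | modify (f : Fin k) (n : Fin (N f)) : Prog N
  | dup : Prog N
  | par (p q : Prog N) : Prog N
  | seq (p q : Prog N) : Prog N
  | choice (r : unitInterval) (p q : Prog N) : Prog N
  | star (p : Prog N) : Prog N

/-- The programs `p⁽⁰⁾ = 1` and `p⁽ⁿ⁺¹⁾ = 1 & p ; p⁽ⁿ⁾`. -/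
def Prog.iter {k : ℕ} {N : Fin k → ℕ} (p : Prog N) : ℕ → Prog N
  | 0 => .filter .skip
  | n + 1 => .par (.filter .skip) (.seq p (p.iter n))

/-! Topology, Borel sets and order. Sets of histories carry Mathlib's product σ-algebra;
`borel_cantor` shows that it consists of the Borel sets of the Cantor topology. -/

/-- The Cantor topology on sets of histories, generated by the sets `{c | h ∈ c}` and their
complements. -/
@[reducible]
def cantor {k : ℕ} (N : Fin k → ℕ) : TopologicalSpace (Set (History N)) :=
  TopologicalSpace.generateFrom
    {U | ∃ h : History N, U = {c | h ∈ c} ∨ U = {c | h ∈ c}ᶜ}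

theorem borel_cantor {k : ℕ} (N : Fin k → ℕ) :
    @borel (Set (History N)) (cantor N) = Set.instMeasurableSpace := by
  have hc : (({U | ∃ h : History N, U = {c | h ∈ c} ∨ U = {c | h ∈ c}ᶜ} :
      Set (Set (Set (History N))))).Countable := by
    have : {U : Set (Set (History N)) | ∃ h : History N, U = {c | h ∈ c} ∨ U = {c | h ∈ c}ᶜ} =
        ⋃ h : History N, {{c | h ∈ c}, {c | h ∈ c}ᶜ} := by
      ext U; simp
    rw [this]
    exact Set.countable_iUnion fun h => (Set.toFinite _).countable
  let _ : TopologicalSpace (Set (History N)) := cantor N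
  have : SecondCountableTopology (Set (History N)) := ⟨_, hc, rfl⟩
  rw [borel_eq_generateFrom_of_subbasis (t := cantor N) rfl]
  apply le_antisymm
  · refine MeasurableSpace.generateFrom_le ?_
    rintro _ ⟨h, rfl | rfl⟩
    · exact measurableSet_setOfPred.2 (measurable_set_mem h)
    · exact (measurableSet_setOfPred.2 (measurable_set_mem h)).compl
  · intro s hs
    have key : @Measurable _ _ (MeasurableSpace.generateFrom
        {U | ∃ h : History N, U = {c | h ∈ c} ∨ U = {c | h ∈ c}ᶜ})
        Set.instMeasurableSpace (id : Set (History N) → Set (History N)) := by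
      refine (@measurable_set_iff _ _ (MeasurableSpace.generateFrom _) _).2 fun h => ?_
      refine (@measurableSet_setOfPred _ (MeasurableSpace.generateFrom _) _).1 ?_
      exact MeasurableSpace.measurableSet_generateFrom ⟨h, Or.inl rfl⟩
    exact key hs

/-- Open sets of the Scott topology of sets of histories ordered by inclusion. -/
def ScottOpen {k : ℕ} {N : Fin k → ℕ} (B : Set (Set (History N))) : Prop :=
  @IsOpen (Set (History N)) (Topology.scott (Set (History N)) univ) B

theorem scottOpen_iff {k : ℕ} {N : Fin k → ℕ} (B : Set (Set (History N))) :
    ScottOpen B ↔ IsUpperSet B ∧ ∀ C : Set (Set (History N)), C.Nonempty →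
      DirectedOn (· ⊆ ·) C → ⋃₀ C ∈ B → (C ∩ B).Nonempty := by
  let _ : TopologicalSpace (Set (History N)) := Topology.scott (Set (History N)) univ
  have : Topology.IsScott (Set (History N)) univ := ⟨rfl⟩
  have := Topology.IsScott.isOpen_iff_isUpperSet_and_dirSupInaccOn (D := univ) (s := B)
  refine this.trans (and_congr_right fun _ => ⟨fun h C h1 h2 h3 => ?_, fun h C _ h1 h2 a h3 h4 => ?_⟩)
  · exact h (mem_univ _) h1 h2 (isLUB_sSup C) h3
  · have : a = ⋃₀ C := h3.unique (isLUB_sSup C)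
    exact h C h1 h2 (this ▸ h4)

/-- The order `μ ⊑ ν` on measures: `μ B ≤ ν B` for every Scott-open `B`. -/
def DistLE {k : ℕ} {N : Fin k → ℕ} (μ ν : Measure (Set (History N))) : Prop :=
  ∀ B : Set (Set (History N)), ScottOpen B → μ B ≤ ν B

theorem DistLE.antisymm {k : ℕ} {N : Fin k → ℕ} {μ ν : Measure (Set (History N))}
    [IsProbabilityMeasure μ] [IsProbabilityMeasure ν] (h₁ : DistLE μ ν) (h₂ : DistLE ν μ) :
    μ = ν := by
  let C : Set (Set (Set (History N))) := {U | ∃ b : Finset (History N), U = {c | ↑b ⊆ c}}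
  have hgen : (Set.instMeasurableSpace : MeasurableSpace (Set (History N))) =
      MeasurableSpace.generateFrom C := by
    apply le_antisymm
    · intro s hs
      have key : @Measurable _ _ (MeasurableSpace.generateFrom C)
          Set.instMeasurableSpace (id : Set (History N) → Set (History N)) := by
        refine (@measurable_set_iff _ _ (MeasurableSpace.generateFrom _) _).2 fun h => ?_
        refine (@measurableSet_setOfPred _ (MeasurableSpace.generateFrom _) _).1 ?_
        exact MeasurableSpace.measurableSet_generateFrom ⟨{h}, by ext; simp⟩
      exact key hs
    · refine MeasurableSpace.generateFrom_le ?_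
      rintro _ ⟨b, rfl⟩
      have : {c : Set (History N) | ↑b ⊆ c} = ⋂ h ∈ b, {c | h ∈ c} := by
        ext c; simp [Set.subset_def]
      rw [this]
      exact Finset.measurableSet_biInter _ fun h _ => measurableSet_setOfPred.2 (measurable_set_mem h)
  refine ext_of_generate_finite C hgen ?_ ?_ (by simp)
  · classical
    rintro _ ⟨b, rfl⟩ _ ⟨b', rfl⟩ -
    exact ⟨b ∪ b', by ext c; simp⟩
  · rintro _ ⟨b, rfl⟩
    have ho : ScottOpen {c : Set (History N) | ↑b ⊆ c} := by
      rw [scottOpen_iff]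
      refine ⟨fun c d hcd hc => subset_trans hc hcd, fun C hC hd hs => ?_⟩
      obtain ⟨c, hc, hbc⟩ := hd.exists_mem_subset_of_finset_subset_biUnion hC
        (f := id) (s := b) (by simpa [Set.sUnion_eq_biUnion] using hs)
      exact ⟨c, hc, hbc⟩
    exact le_antisymm (h₁ _ ho) (h₂ _ ho)

/-- `μ` is the supremum of `S` in the probability measures ordered by `⊑`. -/
structure IsDistSup {k : ℕ} {N : Fin k → ℕ} (S : Set (Measure (Set (History N))))
    (μ : Measure (Set (History N))) : Prop where
  isProb : IsProbabilityMeasure μ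
  upper : ∀ ν ∈ S, DistLE ν μ
  least : ∀ ρ : Measure (Set (History N)), IsProbabilityMeasure ρ →
    (∀ ν ∈ S, DistLE ν ρ) → DistLE μ ρ

open Classical in
/-- The supremum `⨆ S` of a set of measures in the probability measures ordered by `⊑`; the value
is the zero measure if there is no supremum. -/
noncomputable def distSup {k : ℕ} {N : Fin k → ℕ} (S : Set (Measure (Set (History N)))) :
    Measure (Set (History N)) :=
  if h : ∃ μ, IsDistSup S μ then h.choose else 0

/-! Operations on maps from sets of histories to measures. -/

/-- The unit of the probability monad, that is, the denotation of `1`. -/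
noncomputable def point {k : ℕ} {N : Fin k → ℕ} (a : Set (History N)) : Measure (Set (History N)) :=
  Measure.dirac a

/-- Parallel composition `P & Q`. -/
noncomputable def parK {k : ℕ} {N : Fin k → ℕ} (P Q : Set (History N) → Measure (Set (History N)))
    (a : Set (History N)) : Measure (Set (History N)) :=
  (P a).bind fun b₁ => (Q a).bind fun b₂ => point (b₁ ∪ b₂)

/-- Sequential composition `P ; Q`. -/
noncomputable def seqK {k : ℕ} {N : Fin k → ℕ} (P Q : Set (History N) → Measure (Set (History N)))
    (a : Set (History N)) : Measure (Set (History N)) :=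
  (P a).bind Q

/-- Probabilistic choice `r P + (1 - r) Q`. -/
noncomputable def choiceK {k : ℕ} {N : Fin k → ℕ} (r : unitInterval)
    (P Q : Set (History N) → Measure (Set (History N)))
    (a : Set (History N)) : Measure (Set (History N)) :=
  ENNReal.ofReal r • P a + ENNReal.ofReal (1 - r) • Q a

/-- `P⁽⁰⁾ = 1` and `P⁽ⁿ⁺¹⁾ = 1 & P ; P⁽ⁿ⁾`. -/
noncomputable def iterK {k : ℕ} {N : Fin k → ℕ} (P : Set (History N) → Measure (Set (History N))) :
    ℕ → Set (History N) → Measure (Set (History N))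
  | 0 => point
  | n + 1 => parK point (seqK P (iterK P n))

/-- Iteration `P* = ⨆ₙ P⁽ⁿ⁾`. -/
noncomputable def starK {k : ℕ} {N : Fin k → ℕ} (P : Set (History N) → Measure (Set (History N)))
    (a : Set (History N)) : Measure (Set (History N)) :=
  distSup (range fun n => iterK P n a)

/-! Semantics. -/

/-- The denotation of a predicate. -/
noncomputable def Pred.den {k : ℕ} {N : Fin k → ℕ} :
    Pred N → Set (History N) → Measure (Set (History N))
  | .drop => fun _ => point ∅
  | .skip => fun a => point a
  | .test f n => fun a => point {h ∈ a | h.1 f = n}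
  | .disj t u => parK t.den u.den
  | .conj t u => seqK t.den u.den
  | .neg t => fun a => (t.den a).bind fun b => point (a \ b)

/-- The denotation of a program. -/
noncomputable def Prog.den {k : ℕ} {N : Fin k → ℕ} :
    Prog N → Set (History N) → Measure (Set (History N))
  | .filter t => t.den
  | .modify f n => fun a => point ((fun h => (Function.update h.1 f n, h.2)) '' a)
  | .dup => fun a => point ((fun h => (h.1, h.1 :: h.2)) '' a)
  | .par p q => parK p.den q.den
  | .seq p q => seqK p.den q.den
  | .choice r p q => choiceK r p.den q.den
  | .star p => starK p.den

theorem Prog.den_iter {k : ℕ} {N : Fin k → ℕ} (p : Prog N) (n : ℕ) :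
    (p.iter n).den = iterK p.den n := by
  induction n with
  | zero => rfl
  | succ n ih => simp only [Prog.iter, Prog.den, iterK, ih]; rfl

/-! Continuous Markov kernels. -/

/-- A continuous Markov kernel: a Markov kernel `κ` on sets of histories such that `a ↦ κ a B` is
Scott-continuous for every Scott-open `B`. -/
structure ContKernel {k : ℕ} (N : Fin k → ℕ) where
  kernel : Kernel (Set (History N)) (Set (History N))
  isMarkov : IsMarkovKernel kernel
  continuous : ∀ B : Set (Set (History N)), ScottOpen B → ScottContinuous fun a => kernel a B

noncomputable instance {k : ℕ} {N : Fin k → ℕ} :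
    CoeFun (ContKernel N) fun _ => Set (History N) → Measure (Set (History N)) :=
  ⟨fun P => P.kernel⟩

/-- The order `P ⊑ Q` on continuous kernels: `P a ⊑ Q a` for all `a`. -/
instance {k : ℕ} {N : Fin k → ℕ} : PartialOrder (ContKernel N) where
  le P Q := ∀ a, DistLE (P a) (Q a)
  le_refl _ _ _ _ := le_rfl
  le_trans _ _ _ h₁ h₂ a B hB := (h₁ a B hB).trans (h₂ a B hB)
  le_antisymm P Q h₁ h₂ := by
    obtain ⟨P, hP, _⟩ := P
    obtain ⟨Q, hQ, _⟩ := Q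
    have : P = Q := by
      ext1 a
      exact DistLE.antisymm (h₁ a) (h₂ a)
    subst this
    rfl

end ProbNetKAT
open ProbNetKAT

namespace ProbNetKAT

variable {k : ℕ} {N : Fin k → ℕ}

/-! Finite truncations of sets of histories and Scott continuity. -/

/-! Since there are countably many histories, each set is the increasing union of its finite
truncations `trunc n a`, and Scott openness and Scott continuity can be tested on this sequence
alone (`scottOpen_iff_trunc`, `scottContinuous_iff_trunc`). Directed suprema thus become countable
ones, within reach of monotone convergence.

Superlevel sets of a Scott-continuous function are Scott open, so the layer-cake formula makes its
integral monotone and sequentially continuous in the measure. Together with monotone convergence in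
the integrand this gives `scottContinuous_lintegral`, whence `;` and `&` preserve continuity.

Iteration needs suprema of increasing sequences of probability measures. They come from weak
compactness of the probability measures on Cantor space (`exists_measure_eq_iSup`), and on
Scott-open sets they are computed pointwise. So `starK` is continuous by exchanging suprema, and a
fixpoint by monotone convergence, because probability measures agreeing on Scott-open sets are
equal. Predicates are handled separately, as negation is not monotone. -/

/-- The histories in `a` among the first `n` in a fixed enumeration. -/
def trunc (n : ℕ) (a : Set (History N)) : Set (History N) :=
  {h ∈ a | (exists_injective_nat (History N)).choose h < n}

lemma trunc_subset (n : ℕ) (a : Set (History N)) : trunc n a ⊆ a := fun _ h => h.1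

lemma finite_setOf_index_lt (n : ℕ) :
    {h : History N | (exists_injective_nat (History N)).choose h < n}.Finite :=
  Set.Finite.preimage (exists_injective_nat (History N)).choose_spec.injOn (Set.finite_Iio n)

lemma finite_trunc (n : ℕ) (a : Set (History N)) : (trunc n a).Finite :=
  (finite_setOf_index_lt n).subset fun _ h => h.2

lemma trunc_mono (n : ℕ) : Monotone (trunc n : Set (History N) → Set (History N)) :=
  fun _ _ hab _ h => ⟨hab h.1, h.2⟩

lemma monotone_trunc (a : Set (History N)) : Monotone fun n => trunc n a :=
  fun _ _ hmn _ h => ⟨h.1, h.2.trans_le hmn⟩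

lemma isLUB_trunc (a : Set (History N)) : IsLUB (range fun n => trunc n a) a := by
  refine ⟨?_, fun b hb h hh => ?_⟩
  · rintro _ ⟨n, rfl⟩
    exact trunc_subset n a
  · exact hb (mem_range_self ((exists_injective_nat (History N)).choose h + 1))
      ⟨hh, Nat.lt_succ_self _⟩

/-- Finite sets are compact elements: a directed union covering one already covers it with a single
member. -/
lemma exists_trunc_subset_of_directedOn {d : Set (Set (History N))} {a : Set (History N)}
    (hne : d.Nonempty) (hd : DirectedOn (· ≤ ·) d) (ha : IsLUB d a) (n : ℕ) :
    ∃ c ∈ d, trunc n a ⊆ c := by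
  have : a = ⋃₀ d := ha.unique (isLUB_sSup d)
  refine DirectedOn.exists_mem_subset_of_finite_of_subset_sUnion hne hd (finite_trunc n a) ?_
  exact this ▸ trunc_subset n a

lemma scottContinuous_iff_trunc {f : Set (History N) → ENNReal} :
    ScottContinuous f ↔ Monotone f ∧ ∀ a, f a = ⨆ n, f (trunc n a) := by
  refine ⟨fun hf => ⟨hf.monotone, fun a => ?_⟩, fun ⟨hf, h⟩ d hne hd a ha => ⟨?_, fun b hb => ?_⟩⟩
  · have := hf (range_nonempty fun n => trunc n a)
      ((monotone_trunc a).directed_le.directedOn_range) (isLUB_trunc a)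
    rw [← range_comp] at this
    exact this.unique isLUB_iSup
  · rintro _ ⟨c, hc, rfl⟩
    exact hf (ha.1 hc)
  · rw [h a]
    refine iSup_le fun n => ?_
    obtain ⟨c, hc, hn⟩ := exists_trunc_subset_of_directedOn hne hd ha n
    exact (hf hn).trans (hb (mem_image_of_mem f hc))

lemma scottOpen_iff_trunc {B : Set (Set (History N))} :
    ScottOpen B ↔ IsUpperSet B ∧ ∀ a ∈ B, ∃ n, trunc n a ∈ B := by
  rw [scottOpen_iff]
  refine and_congr_right fun hB => ⟨fun h a ha => ?_, fun h C hne hd hC => ?_⟩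
  · have hu : ⋃₀ (range fun n => trunc n a) = a := (isLUB_sSup _).unique (isLUB_trunc a)
    obtain ⟨_, ⟨n, rfl⟩, hn⟩ := h (range fun n => trunc n a) (range_nonempty _)
      ((monotone_trunc a).directed_le.directedOn_range) (hu.symm ▸ ha)
    exact ⟨n, hn⟩
  · obtain ⟨n, hn⟩ := h _ hC
    obtain ⟨c, hc, hnc⟩ := exists_trunc_subset_of_directedOn hne hd (isLUB_sSup C) n
    exact ⟨c, hc, hB hnc hn⟩

lemma ScottOpen.isUpperSet {B : Set (Set (History N))} (hB : ScottOpen B) : IsUpperSet B :=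
  (scottOpen_iff_trunc.1 hB).1

lemma ScottOpen.trunc_preimage {B : Set (Set (History N))} (hB : ScottOpen B) (m : ℕ) :
    ScottOpen (trunc m ⁻¹' B) := by
  refine scottOpen_iff_trunc.2 ⟨fun a b hab ha => hB.isUpperSet (trunc_mono m hab) ha,
    -- Truncation at `m` is idempotent, so `m` itself is the required index.
    fun a ha => ⟨m, ?_⟩⟩
  have : trunc m (trunc m a) = trunc m a :=
    Subset.antisymm (trunc_subset _ _) fun h hh => ⟨hh, hh.2⟩
  rwa [mem_preimage, this]

lemma ScottOpen.eq_iUnion_trunc_preimage {B : Set (Set (History N))} (hB : ScottOpen B) :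
    B = ⋃ m, trunc m ⁻¹' B := by
  ext a
  simp only [mem_iUnion, mem_preimage]
  exact ⟨(scottOpen_iff_trunc.1 hB).2 a,
    fun ⟨m, hm⟩ => hB.isUpperSet (trunc_subset m a) hm⟩

lemma ScottOpen.monotone_trunc_preimage {B : Set (Set (History N))} (hB : ScottOpen B) :
    Monotone fun m => trunc m ⁻¹' B :=
  fun _ _ hmn a ha => hB.isUpperSet (monotone_trunc a hmn) ha

/-- Reduces Scott-open sets to those determined by finitely many histories, which are clopen in the
Cantor topology. -/
lemma ScottOpen.measure_eq_iSup {B : Set (Set (History N))} (hB : ScottOpen B)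
    (μ : Measure (Set (History N))) : μ B = ⨆ m, μ (trunc m ⁻¹' B) := by
  conv_lhs => rw [hB.eq_iUnion_trunc_preimage]
  exact hB.monotone_trunc_preimage.measure_iUnion

lemma scottOpen_setOf_subset (b : Finset (History N)) :
    ScottOpen {c : Set (History N) | ↑b ⊆ c} := by
  rw [scottOpen_iff]
  refine ⟨fun c d hcd hc => subset_trans hc hcd, fun C hC hd hs => ?_⟩
  obtain ⟨c, hc, hbc⟩ :=
    DirectedOn.exists_mem_subset_of_finite_of_subset_sUnion hC hd b.finite_toSet hs
  exact ⟨c, hc, hbc⟩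

lemma measurableSet_setOf_subset (b : Finset (History N)) :
    MeasurableSet {c : Set (History N) | ↑b ⊆ c} := by
  have : {c : Set (History N) | ↑b ⊆ c} = ⋂ h ∈ b, {c | h ∈ c} := by
    ext c; simp [Set.subset_def]
  rw [this]
  exact Finset.measurableSet_biInter _ fun h _ => measurableSet_setOfPred.2 (measurable_set_mem h)

lemma generateFrom_setOf_subset :
    (Set.instMeasurableSpace : MeasurableSpace (Set (History N))) =
      MeasurableSpace.generateFrom {U | ∃ b : Finset (History N), U = {c | ↑b ⊆ c}} := by
  apply le_antisymm
  · intro s hs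
    have key : @Measurable _ _ (MeasurableSpace.generateFrom
        {U | ∃ b : Finset (History N), U = {c | ↑b ⊆ c}})
        Set.instMeasurableSpace (id : Set (History N) → Set (History N)) := by
      refine (@measurable_set_iff _ _ (MeasurableSpace.generateFrom _) _).2 fun h => ?_
      refine (@measurableSet_setOfPred _ (MeasurableSpace.generateFrom _) _).1 ?_
      exact MeasurableSpace.measurableSet_generateFrom ⟨{h}, by ext; simp⟩
    exact key hs
  · refine MeasurableSpace.generateFrom_le ?_
    rintro _ ⟨b, rfl⟩
    exact measurableSet_setOf_subset b

lemma isPiSystem_setOf_subset :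
    IsPiSystem {U : Set (Set (History N)) | ∃ b : Finset (History N), U = {c | ↑b ⊆ c}} := by
  classical
  rintro _ ⟨b, rfl⟩ _ ⟨b', rfl⟩ -
  exact ⟨b ∪ b', by ext c; simp⟩

/-- A Scott-open set is the union of the principal filters of the finite sets it contains, and there
are only countably many finite sets. -/
lemma ScottOpen.measurableSet {B : Set (Set (History N))} (hB : ScottOpen B) :
    MeasurableSet B := by
  have : B = ⋃ b ∈ {b : Finset (History N) | (b : Set (History N)) ∈ B},
      {c : Set (History N) | ↑b ⊆ c} := by
    ext a
    simp only [mem_iUnion, mem_ofPred_eq, exists_prop]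
    constructor
    · intro ha
      obtain ⟨n, hn⟩ := (scottOpen_iff_trunc.1 hB).2 a ha
      exact ⟨(finite_trunc n a).toFinset, by simpa using hn, by simpa using trunc_subset n a⟩
    · rintro ⟨b, hb, hba⟩
      exact hB.isUpperSet hba hb
  rw [this]
  exact MeasurableSet.biUnion (to_countable _) fun b _ => measurableSet_setOf_subset b

lemma scottOpen_setOf_lt {f : Set (History N) → ENNReal} (hf : ScottContinuous f) (t : ENNReal) :
    ScottOpen {c | t < f c} := by
  refine scottOpen_iff_trunc.2 ⟨fun a b hab ha => lt_of_lt_of_le ha (hf.monotone hab),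
    fun a ha => ?_⟩
  rw [mem_ofPred_eq, (scottContinuous_iff_trunc.1 hf).2 a] at ha
  exact lt_iSup_iff.1 ha

lemma ScottContinuous.measurable_ennreal {f : Set (History N) → ENNReal}
    (hf : ScottContinuous f) : Measurable f :=
  measurable_of_Ioi fun t => (scottOpen_setOf_lt hf t).measurableSet

lemma ScottOpen.preimage {g : Set (History N) → Set (History N)} (hg : ScottContinuous g)
    {B : Set (Set (History N))} (hB : ScottOpen B) : ScottOpen (g ⁻¹' B) := by
  rw [scottOpen_iff] at hB ⊢
  refine ⟨fun a b hab ha => hB.1 (hg.monotone hab) ha, fun C hne hd hC => ?_⟩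
  have h : g (⋃₀ C) = ⋃₀ (g '' C) := (hg hne hd (isLUB_sSup C)).unique (isLUB_sSup _)
  rw [mem_preimage, h] at hC
  obtain ⟨_, ⟨c, hc, rfl⟩, hcB⟩ :=
    hB.2 (g '' C) (hne.image g) (hd.mono_comp fun _ _ h => hg.monotone h) hC
  exact ⟨c, hc, hcB⟩

lemma scottContinuous_union_left (b : Set (History N)) : ScottContinuous fun c => b ∪ c := by
  intro d hne hd a ha
  refine ⟨?_, fun u hu => ?_⟩
  · rintro _ ⟨c, hc, rfl⟩
    exact union_subset_union_right b (ha.1 hc)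
  · obtain ⟨c, hc⟩ := hne
    exact union_subset (subset_union_left.trans (hu (mem_image_of_mem _ hc)))
      (ha.2 fun c hc => subset_union_right.trans (hu (mem_image_of_mem _ hc)))

lemma scottContinuous_union_right (b : Set (History N)) : ScottContinuous fun c => c ∪ b := by
  simpa only [union_comm] using scottContinuous_union_left b

lemma scottContinuous_image (g : History N → History N) :
    ScottContinuous fun a : Set (History N) => g '' a :=
  fun _ _ _ _ ha => Set.image_preimage.isLUB_l_image ha

lemma scottContinuous_sep (p : History N → Prop) :
    ScottContinuous fun a : Set (History N) => {h ∈ a | p h} := by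
  intro d _ _ a ha
  refine GaloisConnection.isLUB_l_image (u := fun b => {h | p h → h ∈ b}) ?_ ha
  exact fun a b => ⟨fun h x hx hp => h ⟨hx, hp⟩, fun h x hx => h hx.1 hx.2⟩

/-! Integrals of Scott-continuous functions. -/

/-- The layer-cake formula expresses the integral through values of `μ` on Scott-open sets, the only
sets that `DistLE` compares. Finiteness of `f` permits the passage to `toReal`. -/
lemma lintegral_eq_lintegral_measure_setOf_lt {f : Set (History N) → ENNReal}
    (hf : ScottContinuous f) (hfin : ∀ a, f a ≠ ⊤) (μ : Measure (Set (History N))) :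
    ∫⁻ a, f a ∂μ = ∫⁻ t in Ioi (0 : ℝ), μ {a | ENNReal.ofReal t < f a} := by
  have h := lintegral_eq_lintegral_meas_lt μ (f := fun a => (f a).toReal)
    (Filter.Eventually.of_forall fun a => ENNReal.toReal_nonneg)
    hf.measurable_ennreal.ennreal_toReal.aemeasurable
  simp only [ENNReal.ofReal_toReal (hfin _)] at h
  rw [h]
  refine setLIntegral_congr_fun measurableSet_Ioi fun t ht => ?_
  simp only [ENNReal.ofReal_lt_iff_lt_toReal (le_of_lt ht) (hfin _)]

lemma DistLE.lintegral_le {μ ν : Measure (Set (History N))} (h : DistLE μ ν)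
    {f : Set (History N) → ENNReal} (hf : ScottContinuous f) (hfin : ∀ a, f a ≠ ⊤) :
    ∫⁻ a, f a ∂μ ≤ ∫⁻ a, f a ∂ν := by
  rw [lintegral_eq_lintegral_measure_setOf_lt hf hfin,
    lintegral_eq_lintegral_measure_setOf_lt hf hfin]
  exact lintegral_mono fun t => h _ (scottOpen_setOf_lt hf _)

lemma lintegral_eq_iSup_of_measure_eq_iSup {μ : ℕ → Measure (Set (History N))}
    {ν : Measure (Set (History N))} (hμ : ∀ m n, m ≤ n → DistLE (μ m) (μ n))
    (hν : ∀ B, ScottOpen B → ν B = ⨆ n, μ n B)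
    {f : Set (History N) → ENNReal} (hf : ScottContinuous f) (hfin : ∀ a, f a ≠ ⊤) :
    ∫⁻ a, f a ∂ν = ⨆ n, ∫⁻ a, f a ∂(μ n) := by
  simp only [lintegral_eq_lintegral_measure_setOf_lt hf hfin]
  rw [← lintegral_iSup]
  · exact lintegral_congr fun t => hν _ (scottOpen_setOf_lt hf _)
  · intro n
    -- Monotone convergence is applied in the level `t`; the integrands are measurable because they
    -- decrease in it.
    refine Antitone.measurable fun s t hst => measure_mono fun a ha => ?_
    exact lt_of_le_of_lt (ENNReal.ofReal_le_ofReal hst) ha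
  · exact fun m n hmn t => hμ m n hmn _ (scottOpen_setOf_lt hf _)

/-! Suprema of increasing sequences of probability measures. -/

/-- Membership depends only on the finitely many coordinates of index below `m`, so the set is
pulled back from a finite discrete space. -/
lemma isClopen_setOf_trunc_mem (B : Set (Set (History N))) (m : ℕ) :
    IsClopen {f : History N → Bool | trunc m {h | f h = true} ∈ B} := by
  let S := {h : History N | (exists_injective_nat (History N)).choose h < m}
  have : Finite S := finite_setOf_index_lt m
  have hr : Continuous fun (f : History N → Bool) (s : S) => f s := by fun_prop
  convert (isClopen_discrete {g : S → Bool | Subtype.val '' {s | g s = true} ∈ B}).preimage hr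
    using 1
  ext f
  simp only [mem_ofPred_eq, mem_preimage]
  congr! 1
  ext h
  simp only [trunc, mem_ofPred_eq, mem_image, Subtype.exists, exists_and_left, exists_prop,
    exists_eq_right_right, S]

/-- A weak limit along an ultrafilter exists by compactness. It is exact on clopen sets, where
monotonicity identifies the limit with the supremum; a general Scott-open set is an increasing union
of such sets, and the two suprema commute. -/
lemma exists_measure_eq_iSup (μ : ℕ → Measure (Set (History N)))
    [∀ n, IsProbabilityMeasure (μ n)] (hμ : ∀ m n, m ≤ n → DistLE (μ m) (μ n)) :
    ∃ ν : Measure (Set (History N)), IsProbabilityMeasure ν ∧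
      ∀ B, ScottOpen B → ν B = ⨆ n, μ n B := by
  classical
  let e : Set (History N) → History N → Bool := fun a h => decide (h ∈ a)
  let i : (History N → Bool) → Set (History N) := fun f => {h | f h = true}
  have hie : ∀ a, i (e a) = a := fun a => by ext h; simp [i, e]
  have he : Measurable e := measurable_pi_iff.2 fun h =>
    (measurable_of_countable fun p : Prop => decide p).comp (measurable_set_mem h)
  have hi : Measurable i := measurable_set_iff.2 fun h =>
    (measurable_of_countable fun b : Bool => b = true).comp (measurable_pi_apply h)
  let M : ℕ → ProbabilityMeasure (History N → Bool) := fun n =>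
    ⟨(μ n).map e, Measure.isProbabilityMeasure_map he.aemeasurable⟩
  obtain ⟨x, hx⟩ : ∃ x, Filter.Tendsto M (Filter.hyperfilter ℕ) (nhds x) :=
    have : Nonempty (ProbabilityMeasure (History N → Bool)) := ⟨M 0⟩
    ⟨_, ((Filter.hyperfilter ℕ).map M).le_nhds_lim⟩
  refine ⟨(x : Measure (History N → Bool)).map i,
    Measure.isProbabilityMeasure_map hi.aemeasurable, fun B hB => ?_⟩
  have hclopen : ∀ m, (x : Measure (History N → Bool)).map i (trunc m ⁻¹' B) =
      ⨆ n, μ n (trunc m ⁻¹' B) := by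
    intro m
    have hm := (hB.trunc_preimage m).measurableSet
    have h1 := ProbabilityMeasure.tendsto_measure_of_null_frontier_of_tendsto' hx
      (E := i ⁻¹' (trunc m ⁻¹' B)) (by
        -- Weak convergence gives convergence on sets with null frontier, and a clopen set has empty
        -- frontier.
        have : frontier (i ⁻¹' (trunc m ⁻¹' B)) = ∅ := (isClopen_setOf_trunc_mem B m).frontier_eq
        simp [this])
    have h2 : ∀ n, (M n : Measure (History N → Bool)) (i ⁻¹' (trunc m ⁻¹' B)) =
        μ n (trunc m ⁻¹' B) := by
      intro n
      change (μ n).map e _ = _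
      rw [Measure.map_apply he (hi hm)]
      congr 1
      ext a
      simp [hie]
    simp only [h2] at h1
    rw [Measure.map_apply hi hm]
    refine tendsto_nhds_unique h1 ((tendsto_atTop_iSup fun m' n hmn =>
      hμ m' n hmn _ (hB.trunc_preimage m)).mono_left ?_)
    exact Nat.hyperfilter_le_atTop
  rw [hB.measure_eq_iSup]
  simp only [hclopen, fun n => hB.measure_eq_iSup (μ n)]
  exact iSup_comm

lemma isDistSup_of_measure_eq_iSup {μ : ℕ → Measure (Set (History N))}
    {ν : Measure (Set (History N))} [IsProbabilityMeasure ν]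
    (hν : ∀ B, ScottOpen B → ν B = ⨆ n, μ n B) : IsDistSup (range μ) ν := by
  refine ⟨inferInstance, ?_, fun ρ _ hρ B hB => ?_⟩
  · rintro _ ⟨n, rfl⟩ B hB
    rw [hν B hB]
    exact le_iSup (fun n => μ n B) n
  · rw [hν B hB]
    exact iSup_le fun n => hρ _ (mem_range_self n) B hB

lemma IsDistSup.unique {S : Set (Measure (Set (History N)))} {μ ν : Measure (Set (History N))}
    (hμ : IsDistSup S μ) (hν : IsDistSup S ν) : μ = ν :=
  have := hμ.isProb
  have := hν.isProb
  DistLE.antisymm (hμ.least ν hν.isProb hν.upper) (hν.least μ hμ.isProb hμ.upper)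

lemma IsDistSup.distSup_eq {S : Set (Measure (Set (History N)))} {μ : Measure (Set (History N))}
    (hμ : IsDistSup S μ) : distSup S = μ := by
  have h : ∃ μ, IsDistSup S μ := ⟨μ, hμ⟩
  rw [distSup, dif_pos h]
  exact h.choose_spec.unique hμ

/-! Continuity of maps from sets of histories to probability measures. -/

/-- `K` takes values in the probability measures and `a ↦ K a B` is Scott-continuous for every
Scott-open `B`. -/
structure IsContKernel (K : Set (History N) → Measure (Set (History N))) : Prop where
  isProb : ∀ a, IsProbabilityMeasure (K a)
  continuous : ∀ B, ScottOpen B → ScottContinuous fun a => K a B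

namespace IsContKernel

variable {P Q : Set (History N) → Measure (Set (History N))}

/-- The sets `{c | ↑b ⊆ c}` with `b` finite are Scott open and form a π-system generating the
σ-algebra, so continuity already implies measurability. -/
lemma measurable (hP : IsContKernel P) : Measurable P :=
  have := hP.isProb
  Measurable.measure_of_isPiSystem_of_isProbabilityMeasure generateFrom_setOf_subset
    isPiSystem_setOf_subset <| by
      rintro _ ⟨b, rfl⟩
      exact (hP.continuous _ (scottOpen_setOf_subset b)).measurable_ennreal

/-- The continuous Markov kernel given by `K`. -/
def toContKernel (hP : IsContKernel P) : ContKernel N where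
  kernel := ⟨P, hP.measurable⟩
  isMarkov := ⟨hP.isProb⟩
  continuous := hP.continuous

lemma ne_top (hP : IsContKernel P) (a : Set (History N)) (B : Set (Set (History N))) :
    P a B ≠ ⊤ :=
  have := hP.isProb a
  measure_ne_top _ _

lemma distLE (hP : IsContKernel P) {a b : Set (History N)} (hab : a ⊆ b) : DistLE (P a) (P b) :=
  fun B hB => (hP.continuous B hB).monotone hab

lemma measure_eq_iSup (hP : IsContKernel P) (a : Set (History N)) {B : Set (Set (History N))}
    (hB : ScottOpen B) : P a B = ⨆ n, P (trunc n a) B :=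
  (scottContinuous_iff_trunc.1 (hP.continuous B hB)).2 a

/-- The argument `a` enters both the measure and the integrand. Each dependence yields a supremum
over truncations, and monotonicity collapses the double supremum to its diagonal. -/
lemma scottContinuous_lintegral (hP : IsContKernel P)
    {F : Set (History N) → Set (History N) → ENNReal}
    (h₁ : ∀ b, ScottContinuous fun a => F a b) (h₂ : ∀ a, ScottContinuous (F a))
    (hfin : ∀ a b, F a b ≠ ⊤) : ScottContinuous fun a => ∫⁻ b, F a b ∂(P a) := by
  refine scottContinuous_iff_trunc.2 ⟨fun a a' haa' => ?_, fun a => ?_⟩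
  · exact (lintegral_mono fun b => (h₁ b).monotone haa').trans
      ((hP.distLE haa').lintegral_le (h₂ a') (hfin a'))
  · have hmono : ∀ m n, m ≤ n → DistLE (P (trunc m a)) (P (trunc n a)) :=
      fun m n hmn => hP.distLE (monotone_trunc a hmn)
    have h : ∀ n, ∫⁻ b, F a b ∂(P (trunc n a)) =
        ⨆ m, ∫⁻ b, F (trunc m a) b ∂(P (trunc n a)) := by
      intro n
      rw [← lintegral_iSup (fun m => (h₂ _).measurable_ennreal)
        fun m m' hm b => (h₁ b).monotone (monotone_trunc a hm)]
      exact lintegral_congr fun b => (scottContinuous_iff_trunc.1 (h₁ b)).2 a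
    rw [lintegral_eq_iSup_of_measure_eq_iSup hmono (fun B hB => hP.measure_eq_iSup a hB) (h₂ a)
      (hfin a)]
    simp only [h]
    refine le_antisymm (iSup_le fun n => iSup_le fun m => ?_)
      (iSup_le fun n => le_iSup_of_le n (le_iSup_of_le n le_rfl))
    -- The term with indices `m` and `n` is at most the diagonal term at their maximum.
    refine le_iSup_of_le (max m n) ?_
    exact (lintegral_mono fun b => (h₁ b).monotone (monotone_trunc a (le_max_left m n))).trans
      ((hmono _ _ (le_max_right m n)).lintegral_le (h₂ _) (hfin _))

lemma point_comp {g : Set (History N) → Set (History N)} (hg : ScottContinuous g) :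
    IsContKernel fun a => point (g a) := by
  refine ⟨fun a => Measure.dirac.isProbabilityMeasure, fun B hB => ?_⟩
  have hB' := scottOpen_iff_trunc.1 (hB.preimage hg)
  have h : ∀ a, point (g a) B = (g ⁻¹' B).indicator 1 a := fun a =>
    Measure.dirac_apply' _ hB.measurableSet
  simp only [h]
  refine scottContinuous_iff_trunc.2 ⟨fun a b hab => ?_, fun a => ?_⟩
  · beta_reduce
    by_cases ha : a ∈ g ⁻¹' B
    · rw [indicator_of_mem ha, indicator_of_mem (hB'.1 hab ha)]; rfl
    · rw [indicator_of_notMem ha]; exact zero_le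
  · refine le_antisymm ?_ (iSup_le fun n => ?_)
    · by_cases ha : a ∈ g ⁻¹' B
      · obtain ⟨n, hn⟩ := hB'.2 a ha
        refine le_iSup_of_le n ?_
        rw [indicator_of_mem ha, indicator_of_mem hn]; rfl
      · rw [indicator_of_notMem ha]; exact zero_le
    · by_cases ha : trunc n a ∈ g ⁻¹' B
      · rw [indicator_of_mem ha, indicator_of_mem (hB'.1 (trunc_subset n a) ha)]; rfl
      · rw [indicator_of_notMem ha]; exact zero_le

lemma point : IsContKernel (N := N) point := point_comp ScottContinuous.id

lemma isProb_bind {μ : Measure (Set (History N))} [IsProbabilityMeasure μ]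
    (hQ : IsContKernel Q) : IsProbabilityMeasure (μ.bind Q) := by
  refine ⟨?_⟩
  rw [Measure.bind_apply MeasurableSet.univ hQ.measurable.aemeasurable]
  simp [fun a => (hQ.isProb a).measure_univ]

lemma seqK_apply (hQ : IsContKernel Q) (a : Set (History N)) {B : Set (Set (History N))}
    (hB : ScottOpen B) : seqK P Q a B = ∫⁻ b, Q b B ∂(P a) :=
  Measure.bind_apply hB.measurableSet hQ.measurable.aemeasurable

lemma seqK (hP : IsContKernel P) (hQ : IsContKernel Q) : IsContKernel (seqK P Q) := by
  refine ⟨fun a => ?_, fun B hB => ?_⟩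
  · have := hP.isProb a
    exact hQ.isProb_bind
  · simp only [seqK_apply hQ _ hB]
    exact hP.scottContinuous_lintegral (fun b => ScottContinuous.const _)
      (fun a => hQ.continuous B hB) fun _ b => hQ.ne_top b B

lemma bind_union_apply (μ : Measure (Set (History N))) (b : Set (History N))
    {B : Set (Set (History N))} (hB : ScottOpen B) :
    (μ.bind fun c => ProbNetKAT.point (b ∪ c)) B = μ ((fun c => b ∪ c) ⁻¹' B) := by
  have hm := (hB.preimage (scottContinuous_union_left b)).measurableSet
  rw [Measure.bind_apply hB.measurableSet
    (point_comp (scottContinuous_union_left b)).measurable.aemeasurable]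
  rw [← lintegral_indicator_one hm]
  exact lintegral_congr fun c => Measure.dirac_apply' _ hB.measurableSet

/-- Continuity in `b` is continuity of `μ` from below: the preimages of `B` under union with `trunc
n a` increase to the one for `a`. -/
lemma bind_union (μ : Measure (Set (History N))) [IsProbabilityMeasure μ] :
    IsContKernel fun b => μ.bind fun c => ProbNetKAT.point (b ∪ c) := by
  refine ⟨fun b => (point_comp (scottContinuous_union_left b)).isProb_bind, fun B hB => ?_⟩
  simp only [bind_union_apply _ _ hB]
  refine scottContinuous_iff_trunc.2 ⟨fun a b hab => measure_mono fun c hc =>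
    hB.isUpperSet (union_subset_union_left c hab) hc, fun a => ?_⟩
  have hU : (fun c => a ∪ c) ⁻¹' B = ⋃ n, (fun c => trunc n a ∪ c) ⁻¹' B := by
    ext c
    simp only [mem_preimage, mem_iUnion]
    exact ⟨(scottOpen_iff_trunc.1 (hB.preimage (scottContinuous_union_right c))).2 a,
      fun ⟨n, hn⟩ => hB.isUpperSet (union_subset_union_left c (trunc_subset n a)) hn⟩
  rw [hU]
  refine Monotone.measure_iUnion fun m n hmn c hc => ?_
  exact hB.isUpperSet (union_subset_union_left c (monotone_trunc a hmn)) hc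

lemma parK_apply (hQ : IsContKernel Q) (a : Set (History N)) {B : Set (Set (History N))}
    (hB : ScottOpen B) : parK P Q a B = ∫⁻ b, Q a ((fun c => b ∪ c) ⁻¹' B) ∂(P a) := by
  have := hQ.isProb a
  rw [parK, Measure.bind_apply hB.measurableSet (bind_union (Q a)).measurable.aemeasurable]
  exact lintegral_congr fun b => bind_union_apply _ b hB

lemma parK (hP : IsContKernel P) (hQ : IsContKernel Q) : IsContKernel (parK P Q) := by
  refine ⟨fun a => ?_, fun B hB => ?_⟩
  · have := hP.isProb a
    have := hQ.isProb a
    exact (bind_union (Q a)).isProb_bind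
  · simp only [parK_apply hQ _ hB]
    refine hP.scottContinuous_lintegral
      (fun b => hQ.continuous _ (hB.preimage (scottContinuous_union_left b)))
      (fun a => ?_) fun a b => hQ.ne_top a _
    have := hQ.isProb a
    simpa only [bind_union_apply _ _ hB] using (bind_union (Q a)).continuous B hB

lemma choiceK (r : unitInterval) (hP : IsContKernel P) (hQ : IsContKernel Q) :
    IsContKernel (choiceK r P Q) := by
  refine ⟨fun a => ⟨?_⟩, fun B hB => scottContinuous_iff_trunc.2 ⟨fun a b hab => ?_, fun a => ?_⟩⟩
  · have := hP.isProb a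
    have := hQ.isProb a
    simp only [ProbNetKAT.choiceK, Measure.add_apply, Measure.smul_apply, measure_univ, smul_eq_mul,
      mul_one]
    rw [← ENNReal.ofReal_add r.2.1 (sub_nonneg.2 r.2.2)]
    simp
  · simp only [ProbNetKAT.choiceK, Measure.add_apply, Measure.smul_apply, smul_eq_mul]
    exact add_le_add (mul_le_mul_right (hP.distLE hab B hB) _)
      (mul_le_mul_right (hQ.distLE hab B hB) _)
  · simp only [ProbNetKAT.choiceK, Measure.add_apply, Measure.smul_apply, smul_eq_mul]
    rw [hP.measure_eq_iSup a hB, hQ.measure_eq_iSup a hB, ENNReal.mul_iSup, ENNReal.mul_iSup,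
      ENNReal.iSup_add_iSup_of_monotone]
    · exact fun m n hmn => mul_le_mul_right (hP.distLE (monotone_trunc a hmn) B hB) _
    · exact fun m n hmn => mul_le_mul_right (hQ.distLE (monotone_trunc a hmn) B hB) _

/-! Iteration. -/

lemma parK_point_apply (hQ : IsContKernel Q) (a : Set (History N)) {B : Set (Set (History N))}
    (hB : ScottOpen B) :
    ProbNetKAT.parK ProbNetKAT.point Q a B = Q a ((fun c => a ∪ c) ⁻¹' B) := by
  have := hQ.isProb a
  rw [parK_apply hQ a hB, ProbNetKAT.point, lintegral_dirac']
  simpa only [bind_union_apply _ _ hB] using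
    ((bind_union (Q a)).continuous B hB).measurable_ennreal

lemma point_distLE_parK_point (hQ : IsContKernel Q) (a : Set (History N)) :
    DistLE (ProbNetKAT.point a) (ProbNetKAT.parK ProbNetKAT.point Q a) := by
  intro B hB
  have := hQ.isProb a
  rw [parK_point_apply hQ a hB, ProbNetKAT.point, Measure.dirac_apply' _ hB.measurableSet]
  by_cases ha : a ∈ B
  · have : (fun c => a ∪ c) ⁻¹' B = univ :=
      eq_univ_of_forall fun c => hB.isUpperSet subset_union_left ha
    rw [this, measure_univ, indicator_of_mem ha]; rfl
  · rw [indicator_of_notMem ha]; exact zero_le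

lemma step_apply (hP : IsContKernel P) (hQ : IsContKernel Q) (a : Set (History N))
    {B : Set (Set (History N))} (hB : ScottOpen B) :
    ProbNetKAT.parK ProbNetKAT.point (ProbNetKAT.seqK P Q) a B =
      ∫⁻ b, Q b ((fun c => a ∪ c) ⁻¹' B) ∂(P a) := by
  rw [parK_point_apply (hP.seqK hQ) a hB,
    seqK_apply hQ a (hB.preimage (scottContinuous_union_left a))]

lemma step_mono {R : Set (History N) → Measure (Set (History N))} (hP : IsContKernel P)
    (hQ : IsContKernel Q) (hR : IsContKernel R) (h : ∀ a, DistLE (Q a) (R a))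
    (a : Set (History N)) :
    DistLE (ProbNetKAT.parK ProbNetKAT.point (ProbNetKAT.seqK P Q) a)
      (ProbNetKAT.parK ProbNetKAT.point (ProbNetKAT.seqK P R) a) := by
  intro B hB
  rw [step_apply hP hQ a hB, step_apply hP hR a hB]
  exact lintegral_mono fun b => h b _ (hB.preimage (scottContinuous_union_left a))

lemma iterK (hP : IsContKernel P) (n : ℕ) : IsContKernel (iterK P n) := by
  induction n with
  | zero => exact point
  | succ n ih => exact point.parK (hP.seqK ih)

lemma iterK_distLE_succ (hP : IsContKernel P) (n : ℕ) (a : Set (History N)) :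
    DistLE (ProbNetKAT.iterK P n a) (ProbNetKAT.iterK P (n + 1) a) := by
  induction n generalizing a with
  | zero => exact point_distLE_parK_point (hP.seqK point) a
  | succ n ih => exact step_mono hP (hP.iterK n) (hP.iterK (n + 1)) ih a

lemma iterK_distLE (hP : IsContKernel P) (a : Set (History N)) (m n : ℕ) (hmn : m ≤ n) :
    DistLE (ProbNetKAT.iterK P m a) (ProbNetKAT.iterK P n a) := fun B hB =>
  monotone_nat_of_le_succ (f := fun n => ProbNetKAT.iterK P n a B)
    (fun n => hP.iterK_distLE_succ n a B hB) hmn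

lemma starK_spec (hP : IsContKernel P) (a : Set (History N)) :
    IsProbabilityMeasure (ProbNetKAT.starK P a) ∧
      ∀ B, ScottOpen B → ProbNetKAT.starK P a B = ⨆ n, ProbNetKAT.iterK P n a B := by
  have := fun n => (hP.iterK n).isProb a
  obtain ⟨ν, hν, h⟩ := exists_measure_eq_iSup (fun n => ProbNetKAT.iterK P n a) (hP.iterK_distLE a)
  rw [ProbNetKAT.starK, (isDistSup_of_measure_eq_iSup h).distSup_eq]
  exact ⟨hν, h⟩

lemma isDistSup_starK (hP : IsContKernel P) (a : Set (History N)) :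
    IsDistSup (range fun n => ProbNetKAT.iterK P n a) (ProbNetKAT.starK P a) :=
  have := (hP.starK_spec a).1
  isDistSup_of_measure_eq_iSup (hP.starK_spec a).2

lemma starK (hP : IsContKernel P) : IsContKernel (starK P) := by
  refine ⟨fun a => (hP.starK_spec a).1, fun B hB => ?_⟩
  simp only [fun a => (hP.starK_spec a).2 B hB]
  refine scottContinuous_iff_trunc.2 ⟨fun a b hab => iSup_mono fun n =>
    (hP.iterK n).distLE hab B hB, fun a => ?_⟩
  rw [iSup_comm]
  exact iSup_congr fun n => (hP.iterK n).measure_eq_iSup a hB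

/-- Monotone convergence moves the supremum out of the integral, turning the step applied to `starK`
into the supremum of the shifted iterates. Agreement on Scott-open sets then determines the measure.
-/
lemma step_starK (hP : IsContKernel P) (a : Set (History N)) :
    ProbNetKAT.parK ProbNetKAT.point (ProbNetKAT.seqK P (ProbNetKAT.starK P)) a =
      ProbNetKAT.starK P a := by
  have h : ∀ B, ScottOpen B →
      ProbNetKAT.parK ProbNetKAT.point (ProbNetKAT.seqK P (ProbNetKAT.starK P)) a B =
        ProbNetKAT.starK P a B := by
    intro B hB
    have hB' := hB.preimage (scottContinuous_union_left a)
    rw [step_apply hP hP.starK a hB, (hP.starK_spec a).2 B hB]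
    simp only [fun b => (hP.starK_spec b).2 _ hB']
    rw [lintegral_iSup (fun n => ((hP.iterK n).continuous _ hB').measurable_ennreal)
      fun m n hmn b => hP.iterK_distLE b m n hmn _ hB']
    have hs : ∀ n, ∫⁻ b, ProbNetKAT.iterK P n b ((fun c => a ∪ c) ⁻¹' B) ∂(P a) =
        ProbNetKAT.iterK P (n + 1) a B := fun n => (step_apply hP (hP.iterK n) a hB).symm
    simp only [hs]
    exact Monotone.iSup_nat_add (f := fun n => ProbNetKAT.iterK P n a B)
      (fun m n hmn => hP.iterK_distLE a m n hmn B hB) 1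
  have := (point.parK (hP.seqK hP.starK)).isProb a
  have := hP.starK.isProb a
  exact DistLE.antisymm (fun B hB => (h B hB).le) fun B hB => (h B hB).ge

end IsContKernel

lemma ContKernel.isContKernel (P : ContKernel N) : IsContKernel (P : Set (History N) → _) :=
  ⟨P.isMarkov.isProbabilityMeasure, P.continuous⟩

/-! Programs. -/

lemma point_bind (a : Set (History N)) {f : Set (History N) → Measure (Set (History N))}
    (hf : Measurable f) : (point a).bind f = f a :=
  Measure.dirac_bind hf a

/-- Continuity is not inductive through negation, since `a \ b` is antitone in `b`. The stronger
invariant that a predicate filters histories one at a time does pass through it. -/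
lemma Pred.exists_den_eq (t : Pred N) :
    ∃ p : History N → Prop, t.den = fun a => point {h ∈ a | p h} := by
  have hm := fun p : History N → Prop => (IsContKernel.point_comp (scottContinuous_sep p)).measurable
  induction t with
  | drop => exact ⟨fun _ => False, by simp [Pred.den]⟩
  | skip => exact ⟨fun _ => True, by simp [Pred.den]⟩
  | test f n => exact ⟨fun h => h.1 f = n, rfl⟩
  | disj t u iht ihu =>
    obtain ⟨p, hp⟩ := iht
    obtain ⟨q, hq⟩ := ihu
    refine ⟨fun h => p h ∨ q h, funext fun a => ?_⟩
    rw [Pred.den, hp, hq, parK]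
    have := IsContKernel.point.isProb {h ∈ a | q h}
    rw [point_bind _ (IsContKernel.bind_union (point {h ∈ a | q h})).measurable,
      point_bind _ (IsContKernel.point_comp (scottContinuous_union_left _)).measurable]
    congr 1
    ext h
    simp [and_or_left]
  | conj t u iht ihu =>
    obtain ⟨p, hp⟩ := iht
    obtain ⟨q, hq⟩ := ihu
    refine ⟨fun h => p h ∧ q h, funext fun a => ?_⟩
    rw [Pred.den, hp, hq, seqK, point_bind _ (hm q)]
    simp [and_assoc]
  | neg t iht =>
    obtain ⟨p, hp⟩ := iht
    refine ⟨fun h => ¬ p h, funext fun a => ?_⟩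
    -- This map is not Scott continuous in general, so measurability is checked coordinatewise.
    have hd : Measurable fun b : Set (History N) => point (a \ b) := by
      refine Measure.measurable_dirac.comp (measurable_set_iff.2 fun h => ?_)
      exact (measurable_of_countable fun q : Prop => h ∈ a ∧ ¬ q).comp (measurable_set_mem h)
    rw [Pred.den, hp]
    beta_reduce
    rw [point_bind _ hd]
    congr 1
    ext h
    simp +contextual

lemma Prog.isContKernel_den (p : Prog N) : IsContKernel p.den := by
  induction p with
  | filter t =>
    obtain ⟨p, hp⟩ := t.exists_den_eq
    rw [Prog.den, hp]
    exact .point_comp (scottContinuous_sep p)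
  | modify f n => exact .point_comp (scottContinuous_image _)
  | dup => exact .point_comp (scottContinuous_image _)
  | par p q hp hq => exact hp.parK hq
  | seq p q hp hq => exact hp.seqK hq
  | choice r p q hp hq => exact .choiceK r hp hq
  | star p hp => exact hp.starK

end ProbNetKAT

theorem mainTheorem7 {k : ℕ} (N : Fin k → ℕ) :
    (∀ p : Prog N, ∃ K : ContKernel N, ∀ a, K a = p.den a) ∧
    (∀ P : ContKernel N,
      ∃ (Φ : ContKernel N → ContKernel N) (I : ℕ → ContKernel N) (S : ContKernel N),
        (∀ Q a, Φ Q a = parK point (seqK P Q) a) ∧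
        (∀ n a, I n a = iterK P n a) ∧
        (∀ a, S a = starK P a) ∧
        Monotone I ∧
        (∀ a, IsDistSup (Set.range fun n => I n a) (S a)) ∧
        IsLUB (Set.range I) S ∧
        IsLeast {Q | Φ Q = Q} S) := by
  refine ⟨fun p => ⟨p.isContKernel_den.toContKernel, fun a => rfl⟩, fun P => ?_⟩
  have hP := P.isContKernel
  let Φ : ContKernel N → ContKernel N := fun Q =>
    (IsContKernel.point.parK (hP.seqK Q.isContKernel)).toContKernel
  let I : ℕ → ContKernel N := fun n => (hP.iterK n).toContKernel
  have hlub : IsLUB (Set.range I) hP.starK.toContKernel := by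
    refine ⟨?_, fun Q hQ a => (hP.isDistSup_starK a).least _ (Q.isContKernel.isProb a) ?_⟩
    · rintro _ ⟨n, rfl⟩ a
      exact (hP.isDistSup_starK a).upper _ (mem_range_self n)
    · rintro _ ⟨n, rfl⟩
      exact hQ (mem_range_self n) a
  refine ⟨Φ, I, hP.starK.toContKernel, fun _ _ => rfl, fun _ _ => rfl, fun _ => rfl,
    fun m n hmn a => hP.iterK_distLE a m n hmn, hP.isDistSup_starK, hlub, ?_, fun Q hQ => ?_⟩
  · have h := hP.step_starK
    exact le_antisymm (fun a B _ => (DFunLike.congr_fun (h a) B).le)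
      fun a B _ => (DFunLike.congr_fun (h a) B).ge
  · have hQ' : Φ Q = Q := hQ
    -- It suffices to bound every iterate by the fixpoint `Q`. Rewriting `Q` as `Φ Q` makes the
    -- induction step an instance of monotonicity.
    refine hlub.2 ?_
    rintro _ ⟨n, rfl⟩
    induction n with
    | zero =>
      rw [← hQ']
      exact fun a => IsContKernel.point_distLE_parK_point (hP.seqK Q.isContKernel) a
    | succ n ih =>
      rw [← hQ']
      exact fun a => IsContKernel.step_mono hP (hP.iterK n) Q.isContKernel ih a
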